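/- Let $P(\lambda)=A_m\lambda^m+\dots+A_1\lambda+A_0$ be an $n\times n$ matrix polynomial with coefficients $A_j\in\mathbb{C}^{n\times n}$ and $\det A_m\neq 0$, and let $\mu_1\neq\mu_2$ be two complex numbers. Put $$P[\mu_1,\mu_2]=\frac{P(\mu_1)-P(\mu_2)}{\mu_1-\mu_2},\qquad F[P(\mu_1,\mu_2);\gamma]=\begin{bmatrix}P(\mu_1)&0\\ \gamma P[\mu_1,\mu_2]&P(\mu_2)\end{bmatrix}\in\mathbb{C}^{2n\times 2n}\quad(\gamma\in\mathbb{C}),$$ and let $s_1(M)\ge s_2(M)\ge\dots\ge s_{2n}(M)$ denote the singular values of a $2n\times 2n$ matrix $M$. Suppose that $\gamma_*>0$ is a point at which the function $\gamma\mapsto s_{2n-1}(F[P(\mu_1,\mu_2);\gamma])$ attains its maximum over the real numbers $\gamma\ge 0$, and that $s_*:=s_{2n-1}(F[P(\mu_1,\mu_2);\gamma_*])>0$. Then there exist unit vectors $u=\begin{bmatrix}u_1\\u_2\end{bmatrix}$ and $v=\begin{bmatrix}v_1\\v_2\end{bmatrix}$ in $\mathbb{C}^{2n}$ $(u_k,v_k\in\mathbb{C}^n)$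 that form a pair of left and right singular vectors of $F[P(\mu_1,\mu_2);\gamma_*]$ for $s_*$, that is, $$F[P(\mu_1,\mu_2);\gamma_*]\,v=s_*u,\qquad u^*F[P(\mu_1,\mu_2);\gamma_*]=s_*v^*,$$ such that 1. $u_2^*P[\mu_1,\mu_2]v_1=0$, 2. $u_2^*u_1=v_2^*v_1$, and 3. the $n\times 2$ matrices $U=[u_1\ u_2]$ and $V=[v_1\ v_2]$ satisfy $U^*U=V^*V$. -/

import Mathlib

open scoped Matrix

/-- The value `P(z) = A_m z^m + ⋯ + A_1 z + A_0` of the `n × n` matrix polynomial with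
coefficients `A_0, …, A_m`. -/
def matPolyEval {n m : ℕ} (A : Fin (m + 1) → Matrix (Fin n) (Fin n) ℂ) (z : ℂ) :
    Matrix (Fin n) (Fin n) ℂ :=
  ∑ j : Fin (m + 1), z ^ (j : ℕ) • A j

/-- The divided difference `P[μ₁, μ₂] = (P(μ₁) - P(μ₂)) / (μ₁ - μ₂)` (for `μ₁ ≠ μ₂`). -/
noncomputable def matPolyDivDiff {n m : ℕ} (A : Fin (m + 1) → Matrix (Fin n) (Fin n) ℂ)
    (μ₁ μ₂ : ℂ) : Matrix (Fin n) (Fin n) ℂ :=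
  (μ₁ - μ₂)⁻¹ • (matPolyEval A μ₁ - matPolyEval A μ₂)

/-- The `2n × 2n` matrix `F[P(μ₁, μ₂); γ]`, with block rows `(P(μ₁), 0)` and
`(γ P[μ₁, μ₂], P(μ₂))`. -/
noncomputable def blockF {n m : ℕ} (A : Fin (m + 1) → Matrix (Fin n) (Fin n) ℂ)
    (μ₁ μ₂ γ : ℂ) : Matrix (Fin n ⊕ Fin n) (Fin n ⊕ Fin n) ℂ :=
  Matrix.fromBlocks (matPolyEval A μ₁) 0 (γ • matPolyDivDiff A μ₁ μ₂) (matPolyEval A μ₂)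

/-- The `k`-th singular value `s_k(M)`, `k = 1, 2, …`, in decreasing order and counted with
multiplicity. (Mathlib's `LinearMap.singularValues` starts with index `0`.) -/
noncomputable def matSingularValue {ι : Type*} [Fintype ι] [DecidableEq ι]
    (M : Matrix ι ι ℂ) (k : ℕ) : ℝ :=
  (Matrix.toEuclideanLin M).singularValues (k - 1)

/-- `u` and `v` are a pair of (unit) left and right singular vectors of `M` for the value `s`:
`M v = s u` and `u* M = s v*`. -/
def IsSingularPair {ι : Type*} [Fintype ι] (M : Matrix ι ι ℂ) (s : ℝ) (u v : ι → ℂ) : Prop :=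
  star u ⬝ᵥ u = 1 ∧ star v ⬝ᵥ v = 1 ∧
    M *ᵥ v = (s : ℂ) • u ∧ star u ᵥ* M = (s : ℂ) • star v

/-- The `n × 2` matrix `[x y]` with columns `x` and `y`. -/
def twoCols {n : ℕ} (x y : Fin n → ℂ) : Matrix (Fin n) (Fin 2) ℂ :=
  Matrix.of fun i j => ![x i, y i] j

/-! The singular value may be multiple, hence not differentiable in `γ`, so one works with the whole
right singular space `W = ker (T* T - s²)`. The first variation of `‖T x‖²` along `R` is, up to a
factor 2, the Hermitian form `Re ⟨T x, R x⟩`. If it had no zero on `W` apart from `0`, it would have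
constant sign there, and by max-min a small step along `R` or `-R` would raise the singular value.
So at the interior maximum some unit `v` in `W` is a zero, and `u = s⁻¹ F v` satisfies `Re (u₂*
P[μ₁, μ₂] v₁) = 0`. The block equations do the rest (`IsSingularPair.block_orthogonality`): `γ u₂*
P[μ₁, μ₂] v₁` is automatically real, hence zero, and the equalities between `u` and `v` follow. -/

section SingularValues

open Module InnerProductSpace

variable {E F : Type*} [NormedAddCommGroup E] [InnerProductSpace ℂ E] [FiniteDimensional ℂ E]
  [NormedAddCommGroup F] [InnerProductSpace ℂ F] [FiniteDimensional ℂ F]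

/-! ### Max-min estimates for singular values. -/

/-- The subspace orthogonal to a finite set `s` of basis vectors has dimension at least
`n - #s`. -/
theorem OrthonormalBasis.finrank_le_finrank_orthogonal_add_card {n : ℕ}
    (e : OrthonormalBasis (Fin n) ℂ E) (s : Finset (Fin n)) :
    finrank ℂ E ≤ finrank ℂ (Submodule.span ℂ (e '' (s : Set (Fin n))))ᗮ + s.card := by
  classical
  have h := Submodule.finrank_add_finrank_orthogonal
    (Submodule.span ℂ (e '' (s : Set (Fin n))))
  have h2 : finrank ℂ (Submodule.span ℂ (e '' (s : Set (Fin n)))) ≤ s.card := by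
    rw [← Finset.coe_image]
    exact (finrank_span_finset_le_card _).trans Finset.card_image_le
  omega

omit [FiniteDimensional ℂ E] in
theorem OrthonormalBasis.inner_eq_zero_of_mem_orthogonal {n : ℕ}
    (e : OrthonormalBasis (Fin n) ℂ E) {s : Finset (Fin n)} {x : E}
    (hx : x ∈ (Submodule.span ℂ (e '' (s : Set (Fin n))))ᗮ) {j : Fin n} (hj : j ∈ s) :
    inner ℂ (e j) x = 0 :=
  (Submodule.mem_orthogonal _ _).1 hx _ (Submodule.subset_span ⟨j, hj, rfl⟩)

theorem LinearMap.inner_eigenvectorBasis_adjoint_comp_self (T : E →ₗ[ℂ] F) {n : ℕ}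
    (hn : finrank ℂ E = n) (x : E) (j : Fin n) :
    inner ℂ (T.isSymmetric_adjoint_comp_self.eigenvectorBasis hn j) (T.adjoint (T x)) =
      ((T.singularValues j ^ 2 : ℝ) : ℂ) *
        inner ℂ (T.isSymmetric_adjoint_comp_self.eigenvectorBasis hn j) x := by
  have h := T.isSymmetric_adjoint_comp_self.eigenvectorBasis_apply_self_apply hn x j
  simp only [OrthonormalBasis.repr_apply_apply] at h
  rw [T.sq_singularValues_fin hn]
  exact h

theorem LinearMap.norm_sq_apply_eq_sum_singularValues (T : E →ₗ[ℂ] F) {n : ℕ}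
    (hn : finrank ℂ E = n) (x : E) :
    ‖T x‖ ^ 2 = ∑ j : Fin n, T.singularValues j ^ 2 *
      ‖inner ℂ (T.isSymmetric_adjoint_comp_self.eigenvectorBasis hn j) x‖ ^ 2 := by
  set e := T.isSymmetric_adjoint_comp_self.eigenvectorBasis hn with he
  have h1 : ((‖T x‖ ^ 2 : ℝ) : ℂ) = inner ℂ x (T.adjoint (T x)) := by
    rw [LinearMap.adjoint_inner_right, inner_self_eq_norm_sq_to_K]
    push_cast; rfl
  have h2 := e.sum_inner_mul_inner x (T.adjoint (T x))
  rw [← h1] at h2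
  have h3 : ((‖T x‖ ^ 2 : ℝ) : ℂ) = ((∑ j : Fin n, T.singularValues j ^ 2 *
      ‖inner ℂ (e j) x‖ ^ 2 : ℝ) : ℂ) := by
    rw [← h2]
    push_cast
    refine Finset.sum_congr rfl fun j _ => ?_
    rw [he, T.inner_eigenvectorBasis_adjoint_comp_self hn x j, ← he, ← inner_conj_symm x (e j)]
    have := Complex.conj_mul' (inner ℂ (e j) x)
    push_cast
    rw [← this]
    ring
  exact_mod_cast h3

/-- The span of the eigenvectors of `T* T` belonging to the `i + 1` largest singular values. -/
theorem LinearMap.exists_submodule_singularValues_le (T : E →ₗ[ℂ] F) {i : ℕ}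
    (hi : i < finrank ℂ E) :
    ∃ S : Submodule ℂ E, i < finrank ℂ S ∧ ∀ x ∈ S,
      T.singularValues i ^ 2 * ‖x‖ ^ 2 ≤ ‖T x‖ ^ 2 ∧
      (‖T x‖ ^ 2 = T.singularValues i ^ 2 * ‖x‖ ^ 2 →
        T.adjoint (T x) = ((T.singularValues i ^ 2 : ℝ) : ℂ) • x) := by
  set e := T.isSymmetric_adjoint_comp_self.eigenvectorBasis rfl with he
  let s : Finset (Fin (finrank ℂ E)) := Finset.Ioi ⟨i, hi⟩
  refine ⟨(Submodule.span ℂ (e '' (s : Set (Fin (finrank ℂ E)))))ᗮ, ?_, fun x hx => ?_⟩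
  · have h1 := e.finrank_le_finrank_orthogonal_add_card s
    have h2 : s.card = finrank ℂ E - 1 - i := by simp [s]
    omega
  have hterm : ∀ j : Fin (finrank ℂ E), T.singularValues i ^ 2 * ‖inner ℂ (e j) x‖ ^ 2 ≤
      T.singularValues j ^ 2 * ‖inner ℂ (e j) x‖ ^ 2 := by
    intro j
    by_cases hj : j ∈ s
    · rw [e.inner_eq_zero_of_mem_orthogonal hx hj]; simp
    · have hji : (j : ℕ) ≤ i := by
        simpa [s, Fin.lt_def] using hj
      have := T.singularValues_antitone hji
      have := T.singularValues_nonneg i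
      gcongr
  have hx2 : T.singularValues i ^ 2 * ‖x‖ ^ 2 =
      ∑ j, T.singularValues i ^ 2 * ‖inner ℂ (e j) x‖ ^ 2 := by
    rw [← Finset.mul_sum, e.sum_sq_norm_inner_right]
  rw [hx2, T.norm_sq_apply_eq_sum_singularValues rfl x]
  refine ⟨Finset.sum_le_sum fun j _ => hterm j, fun heq => ?_⟩
  -- Equality of the sums forces it term by term: only coefficients with `σ_j² = σ_i²` survive, so
  -- `x` is an eigenvector or zero.
  have hall := (Finset.sum_eq_sum_iff_of_le fun j _ => hterm j).1 heq.symm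
  refine e.repr.injective (PiLp.ext fun j => ?_)
  rw [e.repr_apply_apply, e.repr_apply_apply, he, T.inner_eigenvectorBasis_adjoint_comp_self rfl x j,
    inner_smul_right, ← he]
  rcases mul_eq_mul_right_iff.1 (hall j (Finset.mem_univ j)) with h | h
  · rw [h]
  · have h0 : inner ℂ (e j) x = 0 := by simpa using h
    simp [h0]

/-- The lower bound half of the max-min principle for singular values. -/
theorem LinearMap.lt_singularValues_of_forall_mem (T : E →ₗ[ℂ] F) {i : ℕ}
    (hi : i < finrank ℂ E) (S : Submodule ℂ E) (hS : i < finrank ℂ S) {c : ℝ}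
    (h : ∀ x ∈ S, ‖x‖ = 1 → c ^ 2 < ‖T x‖ ^ 2) : c < T.singularValues i := by
  set e := T.isSymmetric_adjoint_comp_self.eigenvectorBasis rfl with he
  let s : Finset (Fin (finrank ℂ E)) := Finset.Iio ⟨i, hi⟩
  set K := (Submodule.span ℂ (e '' (s : Set (Fin (finrank ℂ E)))))ᗮ
  have h1 : finrank ℂ E ≤ finrank ℂ K + s.card := e.finrank_le_finrank_orthogonal_add_card s
  have h2 : s.card = i := by simp [s]
  -- `dim S > i` and `dim K ≥ dim E - i`, so the two subspaces meet nontrivially.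
  have hnd : ¬ Disjoint S K := fun hd => by
    have := Submodule.finrank_add_finrank_le_of_disjoint hd
    omega
  rw [Submodule.disjoint_def] at hnd
  push Not at hnd
  obtain ⟨y, hyS, hyK, hy0⟩ := hnd
  have hy : ‖y‖ ≠ 0 := norm_ne_zero_iff.2 hy0
  set x : E := ((‖y‖⁻¹ : ℝ) : ℂ) • y
  have hxn : ‖x‖ = 1 := by
    simp [x, norm_smul, hy]
  have hxK : x ∈ K := K.smul_mem _ hyK
  have hle : ‖T x‖ ^ 2 ≤ T.singularValues i ^ 2 := by
    calc ‖T x‖ ^ 2 = ∑ j : Fin (finrank ℂ E), T.singularValues j ^ 2 * ‖inner ℂ (e j) x‖ ^ 2 :=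
          T.norm_sq_apply_eq_sum_singularValues rfl x
      _ ≤ ∑ j : Fin (finrank ℂ E), T.singularValues i ^ 2 * ‖inner ℂ (e j) x‖ ^ 2 := by
          refine Finset.sum_le_sum fun j _ => ?_
          by_cases hj : j ∈ s
          · rw [e.inner_eq_zero_of_mem_orthogonal hxK hj]; simp
          · have hji : i ≤ (j : ℕ) := by
              simpa [s, Fin.lt_def] using hj
            have := T.singularValues_antitone hji
            have := T.singularValues_nonneg j
            gcongr
      _ = T.singularValues i ^ 2 := by
          rw [← Finset.mul_sum, e.sum_sq_norm_inner_right, hxn]; simp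
  exact lt_of_pow_lt_pow_left₀ 2 (T.singularValues_nonneg i)
    ((h x (S.smul_mem _ hyS) hxn).trans_le hle)

/-! ### First-order perturbation of a singular value. -/

omit [FiniteDimensional ℂ E] [FiniteDimensional ℂ F] in
theorem LinearMap.norm_sq_add_smul_apply (T R : E →ₗ[ℂ] F) (t : ℝ) (x : E) :
    ‖(T + (t : ℂ) • R) x‖ ^ 2 =
      ‖T x‖ ^ 2 + 2 * t * (inner ℂ (T x) (R x)).re + t ^ 2 * ‖R x‖ ^ 2 := by
  have := norm_add_sq (𝕜 := ℂ) (T x) ((t : ℂ) • R x)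
  rw [LinearMap.add_apply, LinearMap.smul_apply, this, inner_smul_right, norm_smul]
  simp [mul_pow]
  ring

omit [FiniteDimensional ℂ F] in
/-- If `‖T x‖` is bounded below by `s` on the unit sphere of `S` and grows to first order in the
direction `R` wherever the bound is attained, then `‖(T + t R) x‖ > s` there for small `t > 0`. -/
theorem LinearMap.exists_forall_sq_lt_norm_sq_add_smul (T R : E →ₗ[ℂ] F) (S : Submodule ℂ E)
    {s : ℝ} (hS : ∀ x ∈ S, ‖x‖ = 1 → s ^ 2 ≤ ‖T x‖ ^ 2)
    (hpos : ∀ x ∈ S, ‖x‖ = 1 → ‖T x‖ ^ 2 = s ^ 2 → 0 < (inner ℂ (T x) (R x)).re) :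
    ∃ δ > 0, ∀ t : ℝ, 0 < t → t < δ → ∀ x ∈ S, ‖x‖ = 1 →
      s ^ 2 < ‖(T + (t : ℂ) • R) x‖ ^ 2 := by
  have : ProperSpace E := FiniteDimensional.proper ℂ E
  have hT : Continuous T := T.continuous_of_finiteDimensional
  have hR : Continuous R := R.continuous_of_finiteDimensional
  have hb : Continuous fun x => (inner ℂ (T x) (R x)).re :=
    Complex.continuous_re.comp (hT.inner hR)
  have hSc : IsClosed (S : Set E) := S.closed_of_finiteDimensional
  -- On the compact set where the linear term does not help, `‖T x‖²` exceeds `s²` by a uniform gap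
  -- `a - s²`; `δ` keeps the linear loss below that gap.
  set K : Set E := Metric.sphere 0 1 ∩ ((S : Set E) ∩ {x | (inner ℂ (T x) (R x)).re ≤ 0})
  have hK : IsCompact K :=
    (isCompact_sphere 0 1).inter_right (hSc.inter (isClosed_le hb continuous_const))
  obtain ⟨a, ha, haK⟩ := hK.exists_forall_le' (f := fun x => ‖T x‖ ^ 2) (a := s ^ 2)
    (hT.norm.pow 2).continuousOn (by
      rintro x ⟨hx1, hxS, hxb⟩
      have hx1 : ‖x‖ = 1 := by simpa using hx1
      refine lt_of_le_of_ne (hS x hxS hx1) fun h => ?_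
      exact absurd (hpos x hxS hx1 h.symm) (not_lt.2 hxb))
  obtain ⟨M, hM⟩ := (isCompact_sphere (0 : E) 1).exists_bound_of_continuousOn hb.continuousOn
  have hM' : 0 < |M| + 1 := by positivity
  refine ⟨(a - s ^ 2) / (2 * (|M| + 1)), div_pos (sub_pos.2 ha) (by positivity),
    fun t ht htδ x hxS hx1 => ?_⟩
  rw [T.norm_sq_add_smul_apply R t x]
  have hR2 : 0 ≤ t ^ 2 * ‖R x‖ ^ 2 := by positivity
  rcases le_or_gt (inner ℂ (T x) (R x)).re 0 with hxb | hxb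
  · have h1 : a ≤ ‖T x‖ ^ 2 := haK x ⟨by simpa using hx1, hxS, hxb⟩
    have h2 := hM x (by simpa using hx1)
    rw [Real.norm_eq_abs] at h2
    have h3 : -(|M| + 1) ≤ (inner ℂ (T x) (R x)).re := by
      linarith [neg_abs_le (inner ℂ (T x) (R x)).re, le_abs_self M]
    rw [lt_div_iff₀ (by positivity)] at htδ
    have h4 := mul_le_mul_of_nonneg_left h3 ht.le
    linarith
  · have := hS x hxS hx1
    have : 0 < t * (inner ℂ (T x) (R x)).re := mul_pos ht hxb
    linarith

omit [FiniteDimensional ℂ F] in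
/-- A Hermitian form without nontrivial zeros on a complex subspace has constant sign there. -/
theorem LinearMap.re_inner_pos_of_forall_ne_zero (T R : E →ₗ[ℂ] F) (W : Submodule ℂ E)
    (h0 : ∀ x ∈ W, x ≠ 0 → (inner ℂ (T x) (R x)).re ≠ 0) {x y : E} (hx : x ∈ W) (hy : y ∈ W)
    (hy0 : y ≠ 0) (hpos : 0 < (inner ℂ (T x) (R x)).re) :
    0 < (inner ℂ (T y) (R y)).re := by
  by_contra hneg
  have hneg : (inner ℂ (T y) (R y)).re < 0 := lt_of_le_of_ne (not_lt.1 hneg) (h0 y hy hy0)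
  have hT : Continuous T := T.continuous_of_finiteDimensional
  have hR : Continuous R := R.continuous_of_finiteDimensional
  have hb : Continuous fun x => (inner ℂ (T x) (R x)).re :=
    Complex.continuous_re.comp (hT.inner hR)
  have hp : Continuous fun t : ℝ => x + (t : ℂ) • (y - x) := by fun_prop
  have hc := hb.comp hp
  obtain ⟨t, -, ht⟩ := intermediate_value_Icc' (zero_le_one (α := ℝ)) hc.continuousOn
    (show (0 : ℝ) ∈ Set.Icc _ _ by constructor <;> simp [hneg.le, hpos.le])
  -- The form vanishes somewhere on the segment, which can only be at the origin. Then `x` and `y`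
  -- are real-proportional, and quadratic scaling contradicts the opposite signs.
  have hz : x + (t : ℂ) • (y - x) = 0 := by
    by_contra hz
    exact h0 _ (W.add_mem hx (W.smul_mem _ (W.sub_mem hy hx))) hz ht
  have hxy : ((1 - t : ℝ) : ℂ) • x = ((-t : ℝ) : ℂ) • y := by
    rw [← sub_eq_zero, ← hz]
    push_cast
    module
  have hscale : ∀ (c : ℝ) (z : E), (inner ℂ (T ((c : ℂ) • z)) (R ((c : ℂ) • z))).re =
      c ^ 2 * (inner ℂ (T z) (R z)).re := by
    intro c z
    simp only [map_smul, inner_smul_left, inner_smul_right, Complex.conj_ofReal]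
    rw [← mul_assoc, ← Complex.ofReal_mul, Complex.re_ofReal_mul]
    ring
  have hq : (1 - t) ^ 2 * (inner ℂ (T x) (R x)).re = (-t) ^ 2 * (inner ℂ (T y) (R y)).re := by
    rw [← hscale, ← hscale, hxy]
  rcases eq_or_ne t 1 with rfl | ht1
  · nlinarith
  · have := mul_pos (pow_pos (abs_pos.2 (sub_ne_zero.2 ht1.symm)) 2) hpos
    rw [sq_abs] at this
    nlinarith [sq_nonneg t]

/-- First-order necessary condition for a local maximum of a singular value along the line
`T + t R`: the first-order variation vanishes at some singular vector. -/
theorem LinearMap.exists_re_inner_eq_zero_of_isLocalMax_singularValues (T R : E →ₗ[ℂ] F) {i : ℕ}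
    (hi : i < finrank ℂ E)
    (hmax : IsLocalMax (fun t : ℝ => (T + (t : ℂ) • R).singularValues i) 0) :
    ∃ x : E, ‖x‖ = 1 ∧ T.adjoint (T x) = ((T.singularValues i ^ 2 : ℝ) : ℂ) • x ∧
      (inner ℂ (T x) (R x)).re = 0 := by
  by_contra hcon
  push Not at hcon
  set s := T.singularValues i with hs
  set W : Submodule ℂ E :=
    LinearMap.ker (T.adjoint ∘ₗ T - ((s ^ 2 : ℝ) : ℂ) • LinearMap.id) with hW
  have hmem : ∀ x, x ∈ W ↔ T.adjoint (T x) = ((s ^ 2 : ℝ) : ℂ) • x := fun x => by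
    rw [hW, LinearMap.mem_ker, LinearMap.sub_apply, sub_eq_zero]; rfl
  have h0 : ∀ x ∈ W, x ≠ 0 → (inner ℂ (T x) (R x)).re ≠ 0 := by
    intro x hx hx0 h
    have hxn : ‖x‖ ≠ 0 := norm_ne_zero_iff.2 hx0
    refine hcon (((‖x‖⁻¹ : ℝ) : ℂ) • x) (by simp [norm_smul, hxn])
      ((hmem _).1 (W.smul_mem _ hx)) ?_
    simp only [map_smul, inner_smul_left, inner_smul_right, Complex.conj_ofReal,
      Complex.re_ofReal_mul, h, mul_zero]
  obtain ⟨S, hSi, hS⟩ := T.exists_submodule_singularValues_le hi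
  have hS1 : ∀ x ∈ S, ‖x‖ = 1 → s ^ 2 ≤ ‖T x‖ ^ 2 := fun x hx hx1 => by
    simpa [hx1] using (hS x hx).1
  have hS2 : ∀ x ∈ S, ‖x‖ = 1 → ‖T x‖ ^ 2 = s ^ 2 → x ∈ W := fun x hx hx1 h =>
    (hmem x).2 ((hS x hx).2 (by simpa [hx1] using h))
  -- The sign `c` selects the side of `0` on which the singular value would strictly increase.
  have key : ∀ c : ℝ, (c = 1 ∨ c = -1) →
      ¬ ∀ x ∈ W, x ≠ 0 → 0 < c * (inner ℂ (T x) (R x)).re := by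
    intro c hc hpos
    obtain ⟨δ, hδ, hlt⟩ := T.exists_forall_sq_lt_norm_sq_add_smul ((c : ℂ) • R) S hS1
      (fun x hx hx1 h => by
        have := hpos x (hS2 x hx hx1 h) (norm_ne_zero_iff.1 (by simp [hx1]))
        rwa [LinearMap.smul_apply, inner_smul_right, Complex.re_ofReal_mul])
    have hcont : Filter.Tendsto (fun t : ℝ => t * c) (nhdsWithin 0 (Set.Ioi 0)) (nhds 0) := by
      have : Continuous fun t : ℝ => t * c := by fun_prop
      simpa using (this.tendsto 0).mono_left nhdsWithin_le_nhds
    have hev := hcont.eventually hmax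
    obtain ⟨t, ht1, ht2⟩ := (hev.and (Ioo_mem_nhdsGT hδ)).exists
    have := (T + (t : ℂ) • ((c : ℂ) • R)).lt_singularValues_of_forall_mem hi S hSi
      (hlt t ht2.1 ht2.2)
    simp only [Complex.ofReal_zero, zero_smul, add_zero, Complex.ofReal_mul, mul_smul] at ht1
    exact absurd ht1 (not_le.2 this)
  by_cases hex : ∃ x ∈ W, 0 < (inner ℂ (T x) (R x)).re
  · obtain ⟨x, hx, hxp⟩ := hex
    refine key 1 (Or.inl rfl) fun y hy hy0 => ?_
    simpa using T.re_inner_pos_of_forall_ne_zero R W h0 hx hy hy0 hxp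
  · push Not at hex
    refine key (-1) (Or.inr rfl) fun y hy hy0 => ?_
    have := lt_of_le_of_ne (hex y hy) (h0 y hy hy0)
    linarith

end SingularValues

/-! ### Singular pairs of block triangular matrices. -/

section BlockTriangular

open Matrix

theorem star_dotProduct_self_eq_ofReal {n : ℕ} (x : Fin n → ℂ) :
    ∃ a : ℝ, star x ⬝ᵥ x = (a : ℂ) :=
  ⟨∑ i, ‖x i‖ ^ 2, by
    simp only [dotProduct, Pi.star_apply, RCLike.star_def, Complex.conj_mul']
    push_cast
    rfl⟩

theorem twoCols_conjTranspose_mul_self_eq {n : ℕ} {u₁ u₂ v₁ v₂ : Fin n → ℂ}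
    (h₁ : star u₁ ⬝ᵥ u₁ = star v₁ ⬝ᵥ v₁) (h₂ : star u₂ ⬝ᵥ u₂ = star v₂ ⬝ᵥ v₂)
    (h : star u₂ ⬝ᵥ u₁ = star v₂ ⬝ᵥ v₁) :
    (twoCols u₁ u₂)ᴴ * twoCols u₁ u₂ = (twoCols v₁ v₂)ᴴ * twoCols v₁ v₂ := by
  have h' : star u₁ ⬝ᵥ u₂ = star v₁ ⬝ᵥ v₂ := by
    have := congrArg star h
    simpa only [star_dotProduct_star, star_star, ← star_dotProduct] using this
  have hc : ∀ (x y : Fin n → ℂ) (j k : Fin 2), ((twoCols x y)ᴴ * twoCols x y) j k =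
      star (![x, y] j) ⬝ᵥ ![x, y] k := by
    intro x y j k
    fin_cases j <;> fin_cases k <;> simp [Matrix.mul_apply, twoCols, dotProduct]
  ext j k
  rw [hc, hc]
  fin_cases j <;> fin_cases k
  · exact h₁
  · exact h'
  · exact h
  · exact h₂

/-- For a singular pair of a block lower triangular matrix `[[A, 0], [γ B, C]]` where `A - C` is a
multiple of `B`, it suffices that the real part of `u₂* B v₁` vanishes. -/
theorem IsSingularPair.block_orthogonality {n : ℕ} {A B C : Matrix (Fin n) (Fin n) ℂ} {δ : ℂ}
    (hABC : A - C = δ • B) {γ s : ℝ} (hγ : 0 < γ) (hs : 0 < s) {u₁ u₂ v₁ v₂ : Fin n → ℂ}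
    (h : IsSingularPair (fromBlocks A 0 ((γ : ℂ) • B) C) s (Sum.elim u₁ u₂) (Sum.elim v₁ v₂))
    (hre : (star u₂ ⬝ᵥ (B *ᵥ v₁)).re = 0) :
    star u₂ ⬝ᵥ (B *ᵥ v₁) = 0 ∧ star u₂ ⬝ᵥ u₁ = star v₂ ⬝ᵥ v₁ ∧
      (twoCols u₁ u₂)ᴴ * twoCols u₁ u₂ = (twoCols v₁ v₂)ᴴ * twoCols v₁ v₂ := by
  obtain ⟨hu, hv, hright, hleft⟩ := h
  have hsC : (s : ℂ) ≠ 0 := by exact_mod_cast hs.ne'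
  have hγC : (γ : ℂ) ≠ 0 := by exact_mod_cast hγ.ne'
  have hstar : ∀ x y : Fin n → ℂ, star (Sum.elim x y) = Sum.elim (star x) (star y) := by
    intro x y; ext (i | i) <;> rfl
  rw [hstar, sumElim_dotProduct_sumElim] at hu hv
  rw [hstar, hstar, vecMul_fromBlocks] at hleft
  rw [fromBlocks_mulVec] at hright
  have hr1 : A *ᵥ v₁ = (s : ℂ) • u₁ := by
    ext i
    simpa using congrFun hright (Sum.inl i)
  have hr2 : (γ : ℂ) • (B *ᵥ v₁) + C *ᵥ v₂ = (s : ℂ) • u₂ := by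
    ext i
    simpa [smul_mulVec] using congrFun hright (Sum.inr i)
  have hl2 : star u₂ ᵥ* C = (s : ℂ) • star v₂ := by
    ext i
    simpa using congrFun hleft (Sum.inr i)
  set z := star u₂ ⬝ᵥ (B *ᵥ v₁) with hz
  -- Pair the second block row with `u₂` and use `u₂* C = s v₂*`; the right-hand side is real, so
  -- `Im z = 0`.
  have hdiff : (γ : ℂ) * z = s * (star u₂ ⬝ᵥ u₂ - star v₂ ⬝ᵥ v₂) := by
    have h1 := congrArg (star u₂ ⬝ᵥ ·) hr2
    simp only [dotProduct_add, dotProduct_smul, smul_eq_mul] at h1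
    rw [dotProduct_mulVec (star u₂) C, hl2, smul_dotProduct, smul_eq_mul] at h1
    rw [hz, mul_sub, ← h1]
    ring
  have hz0 : z = 0 := by
    obtain ⟨a, ha⟩ := star_dotProduct_self_eq_ofReal u₂
    obtain ⟨b, hb⟩ := star_dotProduct_self_eq_ofReal v₂
    refine Complex.ext hre ?_
    rw [ha, hb, ← Complex.ofReal_sub, ← Complex.ofReal_mul] at hdiff
    have := congrArg Complex.im hdiff
    rw [Complex.im_ofReal_mul, Complex.ofReal_im] at this
    exact (mul_eq_zero.1 this).resolve_left hγ.ne'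
  have h22 : star u₂ ⬝ᵥ u₂ = star v₂ ⬝ᵥ v₂ := by
    rw [hz0, mul_zero] at hdiff
    exact sub_eq_zero.1 ((mul_eq_zero.1 hdiff.symm).resolve_left hsC)
  have h11 : star u₁ ⬝ᵥ u₁ = star v₁ ⬝ᵥ v₁ := by
    rw [h22, ← hv] at hu
    exact add_right_cancel hu
  have h21 : star u₂ ⬝ᵥ u₁ = star v₂ ⬝ᵥ v₁ := by
    -- The same quantity equals `s (u₂* u₁ - v₂* v₁)`, by `A v₁ = s u₁` and `u₂* C = s v₂*`.
    have h1 : star u₂ ⬝ᵥ ((A - C) *ᵥ v₁) = 0 := by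
      rw [hABC, smul_mulVec, dotProduct_smul, ← hz, hz0, smul_zero]
    rw [sub_mulVec, dotProduct_sub, hr1, dotProduct_mulVec (star u₂) C, hl2, dotProduct_smul,
      smul_dotProduct, ← smul_sub] at h1
    exact sub_eq_zero.1 ((smul_eq_zero.1 h1).resolve_left hsC)
  exact ⟨hz0, h21, twoCols_conjTranspose_mul_self_eq h11 h22 h21⟩

/-- A unit eigenvector of `M* M` for `s ^ 2`, with `s > 0`, is a right singular vector of `M`. -/
theorem isSingularPair_inv_smul_mulVec {ι : Type*} [Fintype ι] {M : Matrix ι ι ℂ} {s : ℝ}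
    (hs : 0 < s) {v : ι → ℂ} (hv : star v ⬝ᵥ v = 1)
    (h : Mᴴ *ᵥ (M *ᵥ v) = ((s ^ 2 : ℝ) : ℂ) • v) :
    IsSingularPair M s ((s : ℂ)⁻¹ • (M *ᵥ v)) v := by
  have hsC : (s : ℂ) ≠ 0 := by exact_mod_cast hs.ne'
  have hstar : star ((s : ℂ)⁻¹ • (M *ᵥ v)) = (s : ℂ)⁻¹ • star (M *ᵥ v) := by
    simp [star_smul]
  have hleft : star (M *ᵥ v) ᵥ* M = ((s ^ 2 : ℝ) : ℂ) • star v := by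
    have := congrArg star h
    rw [star_mulVec, conjTranspose_conjTranspose, star_smul] at this
    simpa using this
  refine ⟨?_, hv, by rw [smul_inv_smul₀ hsC], ?_⟩
  · rw [hstar, smul_dotProduct, dotProduct_smul, dotProduct_mulVec, hleft, smul_dotProduct, hv]
    simp only [smul_eq_mul]
    push_cast
    field_simp
  · rw [hstar, smul_vecMul, hleft, smul_smul]
    congr 1
    push_cast
    field_simp

theorem matPolyEval_sub_eq_smul_matPolyDivDiff {n m : ℕ}
    (A : Fin (m + 1) → Matrix (Fin n) (Fin n) ℂ) {μ₁ μ₂ : ℂ} (hμ : μ₁ ≠ μ₂) :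
    matPolyEval A μ₁ - matPolyEval A μ₂ = (μ₁ - μ₂) • matPolyDivDiff A μ₁ μ₂ := by
  rw [matPolyDivDiff, smul_inv_smul₀ (sub_ne_zero.2 hμ)]

theorem toEuclideanLin_blockF_add {n m : ℕ} (A : Fin (m + 1) → Matrix (Fin n) (Fin n) ℂ)
    (μ₁ μ₂ γ t : ℂ) :
    toEuclideanLin (blockF A μ₁ μ₂ (γ + t)) = toEuclideanLin (blockF A μ₁ μ₂ γ) +
      t • toEuclideanLin (fromBlocks 0 0 (matPolyDivDiff A μ₁ μ₂) 0) := by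
  rw [← map_smul, ← map_add]
  congr 1
  simp [blockF, fromBlocks_smul, fromBlocks_add, add_smul]

end BlockTriangular

theorem mainTheorem2 {n m : ℕ} (A : Fin (m + 1) → Matrix (Fin n) (Fin n) ℂ)
    (hA : (A (Fin.last m)).det ≠ 0) (μ₁ μ₂ : ℂ) (hμ : μ₁ ≠ μ₂)
    (γs : ℝ) (hγs : 0 < γs)
    (hmax : IsMaxOn (fun γ : ℝ => matSingularValue (blockF A μ₁ μ₂ (γ : ℂ)) (2 * n - 1))
      (Set.Ici 0) γs)
    (s : ℝ) (hs : s = matSingularValue (blockF A μ₁ μ₂ (γs : ℂ)) (2 * n - 1))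
    (hspos : 0 < s) :
    ∃ u₁ u₂ v₁ v₂ : Fin n → ℂ,
      IsSingularPair (blockF A μ₁ μ₂ (γs : ℂ)) s (Sum.elim u₁ u₂) (Sum.elim v₁ v₂) ∧
      star u₂ ⬝ᵥ (matPolyDivDiff A μ₁ μ₂ *ᵥ v₁) = 0 ∧
      star u₂ ⬝ᵥ u₁ = star v₂ ⬝ᵥ v₁ ∧
      (twoCols u₁ u₂)ᴴ * twoCols u₁ u₂ = (twoCols v₁ v₂)ᴴ * twoCols v₁ v₂ := by
  set R : Matrix (Fin n ⊕ Fin n) (Fin n ⊕ Fin n) ℂ :=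
    Matrix.fromBlocks 0 0 (matPolyDivDiff A μ₁ μ₂) 0 with hR
  set M := blockF A μ₁ μ₂ (γs : ℂ) with hM
  -- The second `- 1` converts to zero-based indexing. For `n = 0` the index truncates to `0`, which
  -- `hspos` rules out, as singular values beyond the dimension are `0`.
  have hi : 2 * n - 1 - 1 < Module.finrank ℂ (EuclideanSpace ℂ (Fin n ⊕ Fin n)) := by
    by_contra hlt
    rw [hs, matSingularValue, LinearMap.singularValues_of_finrank_le _ (not_lt.1 hlt)] at hspos
    exact lt_irrefl _ hspos
  have hloc : IsLocalMax (fun t : ℝ => (M.toEuclideanLin +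
      (t : ℂ) • R.toEuclideanLin).singularValues (2 * n - 1 - 1)) 0 := by
    -- Since `γs > 0`, steps of both signs stay in the half-line.
    filter_upwards [Ioi_mem_nhds (neg_lt_zero.2 hγs)] with t ht
    have h := hmax (show γs + t ∈ Set.Ici 0 from by
      have : -γs < t := ht
      exact Set.mem_Ici.2 (by linarith))
    simp only [Set.mem_ofPred_eq, matSingularValue, Complex.ofReal_add] at h
    rw [toEuclideanLin_blockF_add] at h
    simpa only [Complex.ofReal_zero, zero_smul, add_zero] using h
  obtain ⟨x, hx1, hx2, hx3⟩ :=
    LinearMap.exists_re_inner_eq_zero_of_isLocalMax_singularValues _ _ hi hloc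
  have hs' : (Matrix.toEuclideanLin M).singularValues (2 * n - 1 - 1) = s := hs.symm
  rw [hs', ← Matrix.toEuclideanLin_conjTranspose_eq_adjoint] at hx2
  set v : Fin n ⊕ Fin n → ℂ := WithLp.ofLp x with hvdef
  have hv : star v ⬝ᵥ v = 1 := by
    have h := inner_self_eq_norm_sq_to_K (𝕜 := ℂ) x
    rw [EuclideanSpace.inner_eq_star_dotProduct, hx1, dotProduct_comm] at h
    simpa using h
  have hev : Mᴴ *ᵥ (M *ᵥ v) = ((s ^ 2 : ℝ) : ℂ) • v := by
    simpa using congrArg WithLp.ofLp hx2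
  have hpair := isSingularPair_inv_smul_mulVec hspos hv hev
  set u : Fin n ⊕ Fin n → ℂ := (s : ℂ)⁻¹ • (M *ᵥ v) with hu
  have hre : (star (u ∘ Sum.inr) ⬝ᵥ (matPolyDivDiff A μ₁ μ₂ *ᵥ (v ∘ Sum.inl))).re = 0 := by
    rw [EuclideanSpace.inner_eq_star_dotProduct, Matrix.ofLp_toLpLin,
      Matrix.ofLp_toLpLin, Matrix.toLin'_apply, Matrix.toLin'_apply, dotProduct_comm, ← hvdef, hpair.2.2.1] at hx3
    have hb : star u ⬝ᵥ (R *ᵥ v) =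
        star (u ∘ Sum.inr) ⬝ᵥ (matPolyDivDiff A μ₁ μ₂ *ᵥ (v ∘ Sum.inl)) := by
      rw [hR, Matrix.fromBlocks_mulVec]
      simp [dotProduct, Fintype.sum_sum_type]
    rw [star_smul, smul_dotProduct, hb, smul_eq_mul, Complex.star_def, Complex.conj_ofReal,
      Complex.re_ofReal_mul] at hx3
    exact (mul_eq_zero.1 hx3).resolve_left hspos.ne'
  have hpair' : IsSingularPair M s (Sum.elim (u ∘ Sum.inl) (u ∘ Sum.inr))
      (Sum.elim (v ∘ Sum.inl) (v ∘ Sum.inr)) := by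
    rwa [Sum.elim_comp_inl_inr, Sum.elim_comp_inl_inr]
  exact ⟨_, _, _, _, hpair', hpair'.block_orthogonality
    (matPolyEval_sub_eq_smul_matPolyDivDiff A hμ) hγs hspos hre⟩
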